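/- Let $t\ge 1$ and $k\ge 2t$ be fixed integers. For a finite set $V$ with $|V|=v$, let $M$ be the $\binom{v}{t}\times\binom{v}{t}$ matrix whose rows and columns are indexed by the $t$-element subsets of $V$, with entries $M(T,U)=\binom{v-t-i}{k-t-i}$, where $i=|T\setminus U|$. All rows of $M$ have the same sum; let $M_1$ be the matrix obtained from $M$ by replacing its first column (for any chosen ordering of the $t$-subsets) by the constant vector of row sums of $M$. Then there are a real function $\theta_t=\theta_t(v)$ and an integer $v_0$, both depending only on $k$ and $t$, such that $$\theta_t(v)=\binom{v-t}{k-t}+o(v^{k-t})\qquad (v\to\infty),$$ and for every finite set $V$ with $v=|V|\ge v_0$ the least eigenvalue of $M$ is $\theta_t(v)$, and all (complex) eigenvalues of $M_1$ are real and at least $\tfrac12\theta_t(v)$. -/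

import Mathlib

open Filter Asymptotics

/-- The number `ξ_i = binom(v-t-i, k-t-i)`. All subtractions are genuine when
`2 * t ≤ k`, `i ≤ t` and `t + i ≤ v`, the only range in which it is used. -/
def xi (v k t i : ℕ) : ℕ := (v - t - i).choose (k - t - i)

/-- The matrix `M`, indexed by the `t`-element subsets of `V`, with entries
`M(T, U) = ξ_i` for `i = |T \ U|`. -/
def coverageMatrix (V : Type*) [Fintype V] [DecidableEq V] (k t : ℕ) :
    Matrix {T : Finset V // T.card = t} {T : Finset V // T.card = t} ℝ :=
  Matrix.of fun T U => (xi (Fintype.card V) k t (T.1 \ U.1).card : ℝ)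

/-- The matrix obtained from `M` by replacing the column indexed by `W` with the vector of row
sums of `M`. With `W` the first `t`-subset in the chosen ordering this is `M_1`. -/
def coverageMatrixReplaced (V : Type*) [Fintype V] [DecidableEq V] (k t : ℕ)
    (W : {T : Finset V // T.card = t}) :
    Matrix {T : Finset V // T.card = t} {T : Finset V // T.card = t} ℝ :=
  (coverageMatrix V k t).updateCol W fun T => ∑ U, coverageMatrix V k t T U

/-!
Suppose that `A` is Hermitian, `A 1 = r 1` and `θ ≤ A ≤ r` with `θ > 0`, and let `x` be an
eigenvector, with eigenvalue `z`, of the matrix obtained from `A` by replacing column `W` by `r 1`.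
If `x_W = 0` then `x` is an eigenvector of `A`. Otherwise
`u = (r - z) (x - x_W e_W) + r x_W 1` satisfies `A u = z u + z (r - z) x_W e_W` and
`u_W = r x_W`, so that pairing with `u` gives the secular equation
`u* A u - z |u|² = z (r - z) r |x_W|²`. As `θ |u|² ≤ u* A u ≤ r |u|²` and `|u|² ≥ r² |x_W|²`, its
imaginary part forces `z` to be real and its real part then forces `z ≥ θ / 2`.

For the coverage matrix `M`, Vandermonde's identity gives
`M = ∑ j ≤ t, binom(v - 2 t, k - 2 t + j) N_jᵀ N_j`, where `N_j` is the inclusion matrix of `j`-sets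
in `t`-sets. The term `j = t` is `binom(v - 2 t, k - t)` times the identity and the others are
positive semidefinite and vanish on the kernel of `N_(t - 1)`, which is nontrivial because
`binom(v, t - 1) < binom(v, t)`. Hence `binom(v - 2 t, k - t)` is the least eigenvalue of `M`.
The bound `M ≤ r` holds because `r - M` is the Laplacian of the nonnegative weights `M`.
-/

open Matrix

section ReplacedColumn

open scoped ComplexOrder

theorem half_le_of_secular_equation {z : ℂ} {θ r s q ω : ℝ} (hθ : 0 ≤ θ) (hr : 0 < r)
    (hω : 0 < ω) (hs : r ^ 2 * ω ≤ s) (hlow : θ * s ≤ q) (hupp : q ≤ r * s)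
    (h : q - z * s = z * (r - z) * (r * ω)) : ((θ / 2 : ℝ) : ℂ) ≤ z := by
  obtain ⟨a, b⟩ := z
  rw [Complex.ext_iff] at h
  simp only [Complex.sub_re, Complex.sub_im, Complex.mul_re, Complex.mul_im, Complex.ofReal_re,
    Complex.ofReal_im] at h
  obtain ⟨hre, him⟩ := h
  obtain rfl : b = 0 := by
    -- The imaginary part of the equation multiplied by the conjugate of `r - z`.
    have hprod : b * ((r * s - q) + r * ω * ((r - a) ^ 2 + b ^ 2)) = 0 := by
      linear_combination (-b) * hre + (-(r - a)) * him
    by_contra hb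
    have hpos : 0 < r * ω * ((r - a) ^ 2 + b ^ 2) := by positivity
    exact mul_ne_zero hb (by linarith) hprod
  refine ⟨?_, rfl⟩
  by_contra! ha
  rw [Complex.ofReal_re] at ha
  have hcancel : (θ - a) * r * (r * ω) ≤ a * (r - a) * (r * ω) := calc
    (θ - a) * r * (r * ω) = (θ - a) * (r ^ 2 * ω) := by ring
    _ ≤ (θ - a) * s := by gcongr; linarith
    _ ≤ a * (r - a) * (r * ω) := by linarith
  have hquad : (θ - a) * r ≤ a * (r - a) := le_of_mul_le_mul_right hcancel (by positivity)
  have hgap : 0 < (θ - 2 * a) * r := mul_pos (by linarith) hr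
  linarith [sq_nonneg a]

variable {n : Type*}

theorem posSemidef_map_ofReal [Finite n] {M : Matrix n n ℝ} (hM : M.PosSemidef) :
    (M.map Complex.ofReal).PosSemidef := by
  obtain ⟨m, v, rfl⟩ := posSemidef_iff_eq_sum_vecMulVec.1 hM
  refine posSemidef_iff_eq_sum_vecMulVec.2 ⟨m, fun i => Complex.ofReal ∘ v i, ?_⟩
  ext i j
  simp [Matrix.sum_apply, vecMulVec_apply]

variable [Fintype n]

theorem star_dotProduct_self_eq_sum_normSq (u : n → ℂ) :
    star u ⬝ᵥ u = ((∑ i, Complex.normSq (u i) : ℝ) : ℂ) := by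
  simp [dotProduct, Complex.normSq_eq_conj_mul_self]

variable [DecidableEq n]

theorem le_of_posSemidef_sub_smul_one {𝕜 : Type*} [RCLike 𝕜] {A : Matrix n n 𝕜} {c μ : 𝕜}
    (hA : (A - c • 1).PosSemidef) {x : n → 𝕜} (hx : A *ᵥ x = μ • x) (hx0 : x ≠ 0) : c ≤ μ := by
  have hform : 0 ≤ (μ - c) * (star x ⬝ᵥ x) := by
    simpa [sub_mulVec, smul_mulVec, hx, ← sub_smul] using hA.dotProduct_mulVec_nonneg x
  rw [sub_mul, sub_nonneg] at hform
  exact le_of_mul_le_mul_right hform (dotProduct_star_self_pos_iff.2 hx0)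

theorem updateCol_mulVec_one_mulVec {R m : Type*} [CommRing R] (A : Matrix m n R) (W : n)
    (x : n → R) :
    A.updateCol W (A *ᵥ 1) *ᵥ x = A *ᵥ (x + x W • (1 - Pi.single W 1)) := by
  have hA : A.updateCol W (A *ᵥ 1) = A + vecMulVec (A *ᵥ 1 - A.col W) (Pi.single W 1) := by
    ext i j
    rcases eq_or_ne j W with rfl | hj <;> simp [vecMulVec_apply, *]
  simp only [hA, add_mulVec, vecMulVec_mulVec, single_one_dotProduct, mulVec_add, mulVec_smul,
    mulVec_sub, mulVec_single_one, op_smul_eq_smul]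

theorem exists_mulVec_eq_smul_add_single {R : Type*} [CommRing R] {A : Matrix n n R} {r z : R}
    (hone : A *ᵥ 1 = r • 1) {W : n} {x : n → R} (hx : A.updateCol W (A *ᵥ 1) *ᵥ x = z • x) :
    ∃ u : n → R, u W = r * x W ∧ A *ᵥ u = z • u + (z * (r - z) * x W) • Pi.single W 1 := by
  rw [updateCol_mulVec_one_mulVec, mulVec_add, mulVec_smul, mulVec_sub, hone] at hx
  refine ⟨(r - z) • (x - x W • Pi.single W 1) + (r * x W) • 1, by simp, ?_⟩
  simp only [mulVec_add, mulVec_smul, mulVec_sub, hone]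
  linear_combination (norm := module) (r - z) • hx

theorem half_le_of_mulVec_eq_smul_add_single {A : Matrix n n ℂ} {θ r : ℝ} (hθ : 0 ≤ θ)
    (hr : 0 < r) (hlow : (A - (θ : ℂ) • 1).PosSemidef) (hupp : ((r : ℂ) • 1 - A).PosSemidef)
    {W : n} {u : n → ℂ} {z ξ : ℂ} (hξ : ξ ≠ 0) (huW : u W = r * ξ)
    (hu : A *ᵥ u = z • u + (z * (r - z) * ξ) • Pi.single W 1) :
    ((θ / 2 : ℝ) : ℂ) ≤ z := by
  set s : ℝ := ∑ i, Complex.normSq (u i)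
  have hs : star u ⬝ᵥ u = s := star_dotProduct_self_eq_sum_normSq u
  have hform : star u ⬝ᵥ A *ᵥ u = z * s + z * (r - z) * (r * Complex.normSq ξ) := by
    simp only [hu, dotProduct_add, dotProduct_smul, hs, dotProduct_single, Pi.star_apply, huW,
      Complex.normSq_eq_conj_mul_self, Complex.star_def, map_mul, Complex.conj_ofReal, smul_eq_mul]
    ring
  have hlow' := hlow.dotProduct_mulVec_nonneg u
  have hupp' := hupp.dotProduct_mulVec_nonneg u
  rw [sub_mulVec, dotProduct_sub, smul_mulVec, one_mulVec, dotProduct_smul, hs, smul_eq_mul,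
    sub_nonneg] at hlow' hupp'
  obtain ⟨q, hq⟩ : ∃ q : ℝ, q = star u ⬝ᵥ A *ᵥ u :=
    ⟨_, Complex.ext rfl (by simp [(Complex.le_def.1 hlow').2.symm])⟩
  rw [← hq] at hlow' hupp' hform
  have hsW : r ^ 2 * Complex.normSq ξ ≤ s := calc
    r ^ 2 * Complex.normSq ξ = Complex.normSq (u W) := by
      rw [huW, map_mul, Complex.normSq_ofReal, sq]
    _ ≤ s := Finset.single_le_sum (fun i _ => Complex.normSq_nonneg (u i)) (Finset.mem_univ W)
  exact half_le_of_secular_equation hθ hr (Complex.normSq_pos.2 hξ) hsW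
    (by exact_mod_cast hlow') (by exact_mod_cast hupp') (by rw [hform]; ring)

theorem half_le_of_hasEigenvalue_updateCol_mulVec_one {A : Matrix n n ℂ} {θ r : ℝ} (hθ : 0 < θ)
    (hlow : (A - (θ : ℂ) • 1).PosSemidef) (hupp : ((r : ℂ) • 1 - A).PosSemidef)
    (hone : A *ᵥ 1 = (r : ℂ) • 1) {W : n} {z : ℂ}
    (hz : Module.End.HasEigenvalue (toLin' (A.updateCol W (A *ᵥ 1))) z) :
    ((θ / 2 : ℝ) : ℂ) ≤ z := by
  obtain ⟨x, hx, hx0⟩ := hz.exists_hasEigenvector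
  rw [Module.End.mem_eigenspace_iff, toLin'_apply] at hx
  by_cases hxW : x W = 0
  · rw [updateCol_mulVec_one_mulVec, hxW, zero_smul, add_zero] at hx
    have hθz : (θ : ℂ) ≤ z := le_of_posSemidef_sub_smul_one hlow hx hx0
    exact le_trans (by exact_mod_cast half_le_self hθ.le) hθz
  · have hθr : (θ : ℂ) ≤ r :=
      le_of_posSemidef_sub_smul_one hlow hone fun h => one_ne_zero (congrFun h W)
    have hr : 0 < r := hθ.trans_le (by exact_mod_cast hθr)
    obtain ⟨u, huW, hu⟩ := exists_mulVec_eq_smul_add_single hone hx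
    exact half_le_of_mulVec_eq_smul_add_single hθ.le hr hlow hupp hxW huW hu

theorem half_le_of_hasEigenvalue_map_updateCol_mulVec_one {M : Matrix n n ℝ} {θ r : ℝ}
    (hθ : 0 < θ) (hlow : (M - θ • 1).PosSemidef) (hupp : (r • 1 - M).PosSemidef)
    (hone : M *ᵥ 1 = r • 1) {W : n} {z : ℂ}
    (hz : Module.End.HasEigenvalue
      (toLin' ((M.updateCol W (M *ᵥ 1)).map Complex.ofReal)) z) :
    ((θ / 2 : ℝ) : ℂ) ≤ z := by
  have hmap_smul_one (c : ℝ) :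
      (c • (1 : Matrix n n ℝ)).map Complex.ofReal = (c : ℂ) • 1 := by
    ext i j
    rcases eq_or_ne i j with rfl | hij <;> simp [*]
  have hmap_mulVec : M.map Complex.ofReal *ᵥ 1 = Complex.ofReal ∘ (M *ᵥ 1) := by
    ext i
    simp [mulVec, dotProduct]
  refine half_le_of_hasEigenvalue_updateCol_mulVec_one (A := M.map Complex.ofReal) (r := r) hθ
    ?_ ?_ ?_ (W := W) ?_
  · simpa only [Matrix.map_sub _ Complex.ofReal_sub, hmap_smul_one] using
      posSemidef_map_ofReal hlow
  · simpa only [Matrix.map_sub _ Complex.ofReal_sub, hmap_smul_one] using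
      posSemidef_map_ofReal hupp
  · rw [hmap_mulVec, hone]
    ext i
    simp
  · rwa [hmap_mulVec, ← map_updateCol]

end ReplacedColumn

theorem posSemidef_diagonal_mulVec_one_sub {n : Type*} [Fintype n] [DecidableEq n]
    {M : Matrix n n ℝ} (hM : M.IsSymm) (h0 : ∀ i j, 0 ≤ M i j) :
    (diagonal (M *ᵥ 1) - M).PosSemidef := by
  refine .of_dotProduct_mulVec_nonneg ((isSymm_diagonal _).sub hM) fun x => ?_
  have hform : star x ⬝ᵥ (diagonal (M *ᵥ 1) - M) *ᵥ x =
      ∑ i, ∑ j, M i j * (x i ^ 2 - x i * x j) := by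
    simp only [star_trivial, sub_mulVec, dotProduct, Pi.sub_apply, mulVec_diagonal, mul_sub,
      Finset.sum_sub_distrib]
    simp only [mulVec, dotProduct, Pi.one_apply, Finset.sum_mul, Finset.mul_sum]
    congr! 3 <;> ring
  have hswap : ∑ i, ∑ j, M i j * (x i ^ 2 - x i * x j) =
      ∑ i, ∑ j, M i j * (x j ^ 2 - x j * x i) := by
    rw [Finset.sum_comm]
    simp only [hM.apply]
  have hsquares : ∑ i, ∑ j, M i j * (x i - x j) ^ 2 =
      ∑ i, ∑ j, M i j * (x i ^ 2 - x i * x j) + ∑ i, ∑ j, M i j * (x j ^ 2 - x j * x i) := by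
    simp only [← Finset.sum_add_distrib]
    congr! 2
    ring
  have hnonneg : 0 ≤ ∑ i, ∑ j, M i j * (x i - x j) ^ 2 :=
    Finset.sum_nonneg fun i _ => Finset.sum_nonneg fun j _ => mul_nonneg (h0 i j) (sq_nonneg _)
  linarith

theorem exists_ne_zero_mulVec_eq_zero_of_card_lt {K m n : Type*} [Field K] [Fintype m] [Fintype n]
    (A : Matrix m n K) (h : Fintype.card m < Fintype.card n) : ∃ x ≠ 0, A *ᵥ x = 0 := by
  classical
  have hker : LinearMap.ker (toLin' A) ≠ ⊥ :=
    LinearMap.ker_ne_bot_of_finrank_lt (by simpa only [Module.finrank_fintype_fun_eq_card])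
  obtain ⟨x, hx, hx0⟩ := Submodule.exists_mem_ne_zero_of_ne_bot hker
  exact ⟨x, hx0, by rwa [LinearMap.mem_ker, toLin'_apply] at hx⟩

section Choose

theorem choose_lt_choose_succ_of_two_mul_lt {n k : ℕ} (h : 2 * k + 1 < n) :
    n.choose k < n.choose (k + 1) := by
  refine Nat.lt_of_mul_lt_mul_right (a := k + 1) ?_
  rw [Nat.choose_succ_right_eq]
  exact Nat.mul_lt_mul_of_pos_left (by omega) (Nat.choose_pos (by omega))

theorem choose_add_add_eq_sum {n l s t : ℕ} (hst : s ≤ t) :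
    (n + s).choose (l + s) = ∑ j ∈ Finset.range (t + 1), n.choose (l + j) * s.choose j := by
  have hvandermonde : (n + s).choose (l + s) =
      ∑ j ∈ Finset.range (s + 1), n.choose (l + j) * s.choose j := by
    rw [add_comm n, Nat.add_choose_eq, Finset.Nat.sum_antidiagonal_eq_sum_range_succ_mk,
      ← Finset.sum_range_reflect (fun j => n.choose (l + j) * _), eq_comm]
    refine Finset.sum_subset_zero_on_sdiff (by simp) (fun j hj => ?_) fun j hj => ?_
    · simp only [Finset.mem_sdiff, Finset.mem_range] at hj
      rw [Nat.choose_eq_zero_of_lt (by omega), zero_mul]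
    · rw [Finset.mem_range] at hj
      rw [mul_comm, Nat.choose_symm_of_eq_add (n := s) (a := s + 1 - 1 - j) (b := j) (by omega)]
      congr 2
      omega
  rw [hvandermonde]
  refine Finset.sum_subset (Finset.range_mono (by omega)) fun j _ hj => ?_
  rw [Finset.mem_range, not_lt] at hj
  rw [Nat.choose_eq_zero_of_lt (n := s) (by omega), mul_zero]

theorem isEquivalent_choose_sub (m a : ℕ) :
    (fun v : ℕ => ((v - a).choose m : ℝ)) ~[atTop] fun v : ℕ => (v : ℝ) ^ m / m.factorial := by
  have hsub : (fun v : ℕ => ((v - a : ℕ) : ℝ)) ~[atTop] fun v : ℕ => (v : ℝ) := by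
    have hconst : (fun _ : ℕ => -(a : ℝ)) =o[atTop] fun v : ℕ => (v : ℝ) :=
      isLittleO_const_left.2 (.inr (tendsto_norm_atTop_atTop.comp tendsto_natCast_atTop_atTop))
    refine hconst.congr' ?_ .rfl
    filter_upwards [eventually_ge_atTop a] with v hv
    simp [Nat.cast_sub hv]
  exact ((isEquivalent_choose m).comp_tendsto (tendsto_sub_atTop_nat a)).trans
    ((hsub.pow m).div .refl)

theorem isLittleO_choose_sub_sub_choose_sub (m a b : ℕ) :
    (fun v : ℕ => ((v - a).choose m : ℝ) - ((v - b).choose m : ℝ)) =o[atTop]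
      fun v : ℕ => (v : ℝ) ^ m := by
  have h : (fun v : ℕ => ((v - a).choose m : ℝ)) ~[atTop] fun v : ℕ => ((v - b).choose m : ℝ) :=
    (isEquivalent_choose_sub m a).trans (isEquivalent_choose_sub m b).symm
  have hO : (fun v : ℕ => ((v - b).choose m : ℝ)) =O[atTop] fun v : ℕ => (v : ℝ) ^ m :=
    ((isEquivalent_choose_sub m b).trans (isEquivalent_choose m).symm).isBigO.trans
      (isTheta_choose m).isBigO
  exact h.isLittleO.trans_isBigO hO

end Choose

section InclusionMatrix

/-- The inclusion matrix of the `i`-element subsets against the `j`-element subsets of `V`: the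
entry at `(I, J)` is `1` if `I ⊆ J` and `0` otherwise. -/
def inclusionMatrix (R V : Type*) [Zero R] [One R] [DecidableEq V] (i j : ℕ) :
    Matrix {I : Finset V // I.card = i} {J : Finset V // J.card = j} R :=
  of fun I J => if I.1 ⊆ J.1 then 1 else 0

variable {R V : Type*} [DecidableEq V] {i j s t : ℕ}

theorem inclusionMatrix_self [Zero R] [One R] : inclusionMatrix R V t t = 1 := by
  ext T U
  have hTU : T.1 ⊆ U.1 ↔ T = U := by
    rw [Finset.subset_iff_eq_of_card_le (by rw [T.2, U.2]), Subtype.ext_iff]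
  simp only [inclusionMatrix, of_apply, hTU, one_apply]

variable [Fintype V]

theorem card_filter_subset_subset {I T : Finset V} (hIT : I ⊆ T) (hIs : I.card ≤ s) :
    (Finset.univ.filter fun S : {S : Finset V // S.card = s} => I ⊆ S.1 ∧ S.1 ⊆ T).card =
      (T.card - I.card).choose (s - I.card) := by
  rw [← Finset.card_sdiff_of_subset hIT, ← Finset.card_powersetCard]
  refine Finset.card_bij (fun S _ => S.1 \ I) (fun S hS => ?_) (fun S hS S' hS' h => ?_)
    fun D hD => ?_
  · obtain ⟨hIS, hST⟩ := (Finset.mem_filter.1 hS).2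
    exact Finset.mem_powersetCard.2
      ⟨Finset.sdiff_subset_sdiff hST subset_rfl, by rw [Finset.card_sdiff_of_subset hIS, S.2]⟩
  · have hIS := (Finset.mem_filter.1 hS).2.1
    have hIS' := (Finset.mem_filter.1 hS').2.1
    exact Subtype.ext
      (by rw [← Finset.sdiff_union_of_subset hIS, h, Finset.sdiff_union_of_subset hIS'])
  · obtain ⟨hDT, hDs⟩ := Finset.mem_powersetCard.1 hD
    have hdisj : Disjoint D I := (Finset.subset_sdiff.1 hDT).2
    refine ⟨⟨D ∪ I, by rw [Finset.card_union_of_disjoint hdisj]; omega⟩, ?_,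
      Finset.union_sdiff_cancel_right hdisj⟩
    simpa using Finset.union_subset (hDT.trans Finset.sdiff_subset) hIT

section Semiring

variable [Semiring R]

theorem inclusionMatrix_mul (his : i ≤ s) :
    inclusionMatrix R V i s * inclusionMatrix R V s t =
      (t - i).choose (s - i) • inclusionMatrix R V i t := by
  ext I T
  simp only [mul_apply, inclusionMatrix, of_apply, Matrix.smul_apply, ite_zero_mul_ite_zero,
    one_mul, Finset.sum_boole]
  split_ifs with hIT
  · rw [card_filter_subset_subset hIT (I.2.trans_le his), I.2, T.2, nsmul_one]
  · rw [Finset.filter_false_of_mem fun S _ hS => hIT (hS.1.trans hS.2), Finset.card_empty,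
      Nat.cast_zero, smul_zero]

theorem inclusionMatrix_transpose_mul_self_apply (T U : {T : Finset V // T.card = t}) :
    ((inclusionMatrix R V i t)ᵀ * inclusionMatrix R V i t) T U =
      ((T.1 ∩ U.1).card.choose i : R) := by
  have hcard := card_filter_subset_subset (s := i) (Finset.empty_subset (T.1 ∩ U.1)) (by simp)
  simp only [Finset.empty_subset, true_and, Finset.card_empty, Nat.sub_zero] at hcard
  simp only [mul_apply, transpose_apply, inclusionMatrix, of_apply, ite_zero_mul_ite_zero, one_mul,
    Finset.sum_boole, ← Finset.subset_inter_iff, hcard]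

theorem inclusionMatrix_mulVec_one (hij : i ≤ j) :
    inclusionMatrix R V i j *ᵥ 1 = (((Fintype.card V - i).choose (j - i) : ℕ) : R) • 1 := by
  ext I
  have hcard := card_filter_subset_subset (Finset.subset_univ I.1) (I.2.trans_le hij)
  rw [I.2] at hcard
  simpa [mulVec, dotProduct, inclusionMatrix] using congrArg (Nat.cast (R := R)) hcard

theorem inclusionMatrix_transpose_mulVec_one :
    (inclusionMatrix R V i j)ᵀ *ᵥ 1 = ((j.choose i : ℕ) : R) • 1 := by
  ext J
  have hcard := card_filter_subset_subset (s := i) (Finset.empty_subset J.1) (by simp)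
  rw [J.2] at hcard
  simpa [mulVec, dotProduct, inclusionMatrix] using congrArg (Nat.cast (R := R)) hcard

theorem inclusionMatrix_mulVec_eq_zero_of_le [IsAddTorsionFree R]
    {x : {T : Finset V // T.card = t} → R} (his : i ≤ s) (hst : s ≤ t)
    (hx : inclusionMatrix R V s t *ᵥ x = 0) : inclusionMatrix R V i t *ᵥ x = 0 := by
  have hmul : (t - i).choose (s - i) • (inclusionMatrix R V i t *ᵥ x) = 0 := by
    rw [← smul_mulVec, ← inclusionMatrix_mul his, ← mulVec_mulVec, hx, mulVec_zero]
  exact (smul_eq_zero.1 hmul).resolve_left (Nat.choose_pos (by omega)).ne'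

end Semiring

theorem exists_inclusionMatrix_mulVec_eq_zero (K : Type*) [Field K] [CharZero K] (ht : 1 ≤ t)
    (hv : 2 * t ≤ Fintype.card V) :
    ∃ x : {T : Finset V // T.card = t} → K,
      x ≠ 0 ∧ ∀ i < t, inclusionMatrix K V i t *ᵥ x = 0 := by
  obtain ⟨s, rfl⟩ := Nat.exists_eq_add_of_le' ht
  obtain ⟨x, hx0, hx⟩ := exists_ne_zero_mulVec_eq_zero_of_card_lt
    (inclusionMatrix K V s (s + 1))
    (by simpa only [Fintype.card_finset_len] using choose_lt_choose_succ_of_two_mul_lt (by omega))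
  exact ⟨x, hx0, fun i hi =>
    inclusionMatrix_mulVec_eq_zero_of_le (Nat.lt_succ_iff.1 hi) s.le_succ hx⟩

end InclusionMatrix

section CoverageMatrix

variable {V : Type*} [Fintype V] [DecidableEq V] {k t : ℕ}

theorem coverageMatrix_isSymm : (coverageMatrix V k t).IsSymm := by
  ext T U
  have hcard : (U.1 \ T.1).card = (T.1 \ U.1).card :=
    Finset.card_sdiff_comm (by rw [T.2, U.2])
  simp only [coverageMatrix, transpose_apply, of_apply, hcard]

theorem coverageMatrix_eq_sum (hk : 2 * t ≤ k) (hv : 2 * t ≤ Fintype.card V) :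
    coverageMatrix V k t =
      ∑ j ∈ Finset.range (t + 1), ((Fintype.card V - 2 * t).choose (k - 2 * t + j) : ℝ) •
        ((inclusionMatrix ℝ V j t)ᵀ * inclusionMatrix ℝ V j t) := by
  ext T U
  have hcard : (T.1 \ U.1).card + (T.1 ∩ U.1).card = t := by
    rw [Finset.card_sdiff_add_card_inter, T.2]
  have hxi : xi (Fintype.card V) k t (T.1 \ U.1).card =
      (Fintype.card V - 2 * t + (T.1 ∩ U.1).card).choose (k - 2 * t + (T.1 ∩ U.1).card) := by
    rw [xi]
    congr 1 <;> omega
  simp only [coverageMatrix, of_apply, hxi, choose_add_add_eq_sum (le_of_add_le_right hcard.le),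
    Matrix.sum_apply, Matrix.smul_apply, inclusionMatrix_transpose_mul_self_apply, smul_eq_mul]
  push_cast
  rfl

theorem coverageMatrix_eq_smul_one_add_sum (hk : 2 * t ≤ k) (hv : 2 * t ≤ Fintype.card V) :
    coverageMatrix V k t = ((Fintype.card V - 2 * t).choose (k - t) : ℝ) • 1 +
      ∑ j ∈ Finset.range t, ((Fintype.card V - 2 * t).choose (k - 2 * t + j) : ℝ) •
        ((inclusionMatrix ℝ V j t)ᵀ * inclusionMatrix ℝ V j t) := by
  rw [coverageMatrix_eq_sum hk hv, Finset.sum_range_succ, add_comm, inclusionMatrix_self,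
    transpose_one, mul_one, show k - 2 * t + t = k - t by omega]

theorem posSemidef_coverageMatrix_sub_smul_one (hk : 2 * t ≤ k) (hv : 2 * t ≤ Fintype.card V) :
    (coverageMatrix V k t -
      ((Fintype.card V - 2 * t).choose (k - t) : ℝ) • 1).PosSemidef := by
  rw [coverageMatrix_eq_smul_one_add_sum hk hv, add_sub_cancel_left]
  refine posSemidef_sum _ fun j _ => .smul ?_ (Nat.cast_nonneg _)
  rw [← conjTranspose_eq_transpose_of_trivial]
  exact posSemidef_conjTranspose_mul_self _

theorem exists_coverageMatrix_mulVec_one_eq_smul (hk : 2 * t ≤ k) (hv : 2 * t ≤ Fintype.card V) :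
    ∃ r : ℝ, coverageMatrix V k t *ᵥ 1 = r • 1 := by
  rw [coverageMatrix_eq_sum hk hv, sum_mulVec]
  refine ⟨∑ j ∈ Finset.range (t + 1), (Fintype.card V - 2 * t).choose (k - 2 * t + j) *
    ((Fintype.card V - j).choose (t - j) * t.choose j), ?_⟩
  rw [Finset.sum_smul]
  refine Finset.sum_congr rfl fun j hj => ?_
  rw [smul_mulVec, ← mulVec_mulVec,
    inclusionMatrix_mulVec_one (Nat.lt_succ_iff.1 (Finset.mem_range.1 hj)), mulVec_smul,
    inclusionMatrix_transpose_mulVec_one, smul_smul, smul_smul, mul_assoc]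

theorem posSemidef_smul_one_sub_coverageMatrix {r : ℝ} (hr : coverageMatrix V k t *ᵥ 1 = r • 1) :
    (r • 1 - coverageMatrix V k t).PosSemidef := by
  have hdiag : diagonal (coverageMatrix V k t *ᵥ 1) = r • 1 := by
    rw [hr, smul_one_eq_diagonal]
    exact congrArg diagonal (funext fun _ => mul_one r)
  exact hdiag ▸ posSemidef_diagonal_mulVec_one_sub coverageMatrix_isSymm
    fun _ _ => Nat.cast_nonneg _

theorem isLeast_hasEigenvalue_coverageMatrix (ht : 1 ≤ t) (hk : 2 * t ≤ k)
    (hv : 2 * t ≤ Fintype.card V) :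
    IsLeast {μ : ℝ | Module.End.HasEigenvalue (toLin' (coverageMatrix V k t)) μ}
      ((Fintype.card V - 2 * t).choose (k - t) : ℝ) := by
  refine ⟨?_, fun μ hμ => ?_⟩
  · obtain ⟨x, hx0, hx⟩ := exists_inclusionMatrix_mulVec_eq_zero (V := V) ℝ ht hv
    refine Module.End.hasEigenvalue_of_hasEigenvector
      (Module.End.hasEigenvector_iff.2 ⟨Module.End.mem_eigenspace_iff.2 ?_, hx0⟩)
    rw [toLin'_apply, coverageMatrix_eq_smul_one_add_sum hk hv, add_mulVec, smul_mulVec,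
      one_mulVec, sum_mulVec, Finset.sum_eq_zero fun j hj => ?_, add_zero]
    rw [smul_mulVec, ← mulVec_mulVec, hx j (Finset.mem_range.1 hj), mulVec_zero, smul_zero]
  · obtain ⟨x, hx, hx0⟩ := Module.End.HasEigenvalue.exists_hasEigenvector hμ
    rw [Module.End.mem_eigenspace_iff, toLin'_apply] at hx
    exact le_of_posSemidef_sub_smul_one (posSemidef_coverageMatrix_sub_smul_one hk hv) hx hx0

open scoped ComplexOrder in
theorem half_le_of_hasEigenvalue_coverageMatrixReplaced (hk : 2 * t ≤ k)
    (hv : k + t ≤ Fintype.card V) {W : {T : Finset V // T.card = t}} {z : ℂ}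
    (hz : Module.End.HasEigenvalue
      (toLin' ((coverageMatrixReplaced V k t W).map Complex.ofReal)) z) :
    (((Fintype.card V - 2 * t).choose (k - t) / 2 : ℝ) : ℂ) ≤ z := by
  have hv' : 2 * t ≤ Fintype.card V := by omega
  have hpos : 0 < ((Fintype.card V - 2 * t).choose (k - t) : ℝ) :=
    Nat.cast_pos.2 (Nat.choose_pos (by omega))
  obtain ⟨r, hr⟩ := exists_coverageMatrix_mulVec_one_eq_smul hk hv'
  have hreplaced : coverageMatrixReplaced V k t W =
      (coverageMatrix V k t).updateCol W (coverageMatrix V k t *ᵥ 1) := by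
    rw [coverageMatrixReplaced]
    congr 1
    ext T
    simp only [mulVec, dotProduct_one]
  rw [hreplaced] at hz
  exact half_le_of_hasEigenvalue_map_updateCol_mulVec_one hpos
    (posSemidef_coverageMatrix_sub_smul_one hk hv') (posSemidef_smul_one_sub_coverageMatrix hr) hr
    hz

end CoverageMatrix

theorem theorem2 (k t : ℕ) (ht : 1 ≤ t) (hk : 2 * t ≤ k) :
    ∃ θ : ℕ → ℝ,
      ((fun v : ℕ => θ v - ((v - t).choose (k - t) : ℝ)) =o[atTop]
        fun v : ℕ => (v : ℝ) ^ (k - t)) ∧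
      ∃ v₀ : ℕ, ∀ (V : Type*) [Fintype V] [DecidableEq V], v₀ ≤ Fintype.card V →
        IsLeast {μ : ℝ | Module.End.HasEigenvalue (Matrix.toLin' (coverageMatrix V k t)) μ}
          (θ (Fintype.card V)) ∧
        ∀ (W : {T : Finset V // T.card = t}) (z : ℂ),
          Module.End.HasEigenvalue
            (Matrix.toLin' ((coverageMatrixReplaced V k t W).map Complex.ofReal)) z →
          ∃ x : ℝ, z = (x : ℂ) ∧ θ (Fintype.card V) / 2 ≤ x := by
  refine ⟨fun v => ((v - 2 * t).choose (k - t) : ℝ),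
    isLittleO_choose_sub_sub_choose_sub (k - t) (2 * t) t, k + t, fun V _ _ hv =>
      ⟨isLeast_hasEigenvalue_coverageMatrix ht hk (by omega), fun W z hz => ?_⟩⟩
  obtain ⟨hre, him⟩ :=
    Complex.le_def.1 (half_le_of_hasEigenvalue_coverageMatrixReplaced hk hv hz)
  exact ⟨z.re, Complex.ext rfl him.symm, hre⟩
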